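/- Let $(M,g)$ be a smooth $4$-dimensional pseudo-Riemannian manifold with Levi-Civita connection $\nabla$, and let $\mathcal D\subset TM$ be a smooth rank-$2$ distribution that is totally isotropic ($g(Y,Z)=0$ for $Y,Z\in\Gamma(\mathcal D)$) and parallel ($\nabla_XY\in\Gamma(\mathcal D)$ for $X\in\Gamma(TM)$, $Y\in\Gamma(\mathcal D)$); that is, $(M,g)$ is a Walker $4$-manifold of rank $2$ with null parallel distribution $\mathcal D$. If $X_1,X_2$ is a basis of parallel sections of $\mathcal D$ over a non-empty open set $U\subset M$ (so $\nabla X_1=\nabla X_2=0$ on $U$, and $X_1,X_2$ span $\mathcal D$ at each point of $U$), the structure algebra $\mathfrak g_{\mathcal D}$ is the real Lie algebra $\mathrm{Span}_{\mathbb R}\{X_1,X_2\}$ with the Lie bracket of vector fields. Then: (1) For every non-empty open $U\subset M$ and every basis $X_1,X_2$ of parallel sections of $\mathcal D$ over $U$, the space $\mathrm{Span}_{\mathbb R}\{X_1,X_2\}$ is closed under the Lie bracket, and the Lie algebra $\mathfrak g_{\mathcal D}$ is abelian, $\mathfrak g_{\mathcal D}\cong\mathbb R^2$. In particular $\mathfrak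 g_{\mathcal D}$ is not isomorphic to the Lie algebra $\mathfrak{aff}(\mathbb R)$ of the affine group of the line. (2) For every open $U\subset M$, whether or not such a basis exists, any two parallel sections $X,Y$ of $\mathcal D$ over $U$ satisfy $[X,Y]=0$. (3) Every point of $M$ has an open neighbourhood over which $\mathcal D$ is spanned by two smooth, pointwise linearly independent vector fields that commute. -/

import Mathlib

open Bundle VectorField
open scoped Manifold ContDiff

namespace Walker

/-- Euclidean model space of `n`-dimensional manifolds. -/
abbrev Model (n : ℕ) : Type := EuclideanSpace ℝ (Fin n)

section Manifold

variable (n : ℕ) (M : Type*) [TopologicalSpace M] [ChartedSpace (Model n) M]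

/-- (Rough) vector fields on the `n`-manifold `M`. -/
abbrev RoughField : Type _ := (x : M) → TangentSpace (𝓡 n) x

variable {n M}

/-- The vector field `X` is smooth on the set `s`. -/
def SmoothFieldOn [IsManifold (𝓡 n) ∞ M] (X : RoughField n M) (s : Set M) : Prop :=
  ContMDiffOn (𝓡 n) ((𝓡 n).prod 𝓘(ℝ, Model n)) ∞
    (fun x => (⟨x, X x⟩ : TotalSpace (Model n) (TangentSpace (𝓡 n) : M → Type))) s

/-- The vector field `X` is differentiable at `x`. -/
def DiffFieldAt [IsManifold (𝓡 n) ∞ M] (X : RoughField n M) (x : M) : Prop :=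
  MDifferentiableAt (𝓡 n) ((𝓡 n).prod 𝓘(ℝ, Model n))
    (fun x => (⟨x, X x⟩ : TotalSpace (Model n) (TangentSpace (𝓡 n) : M → Type))) x

theorem SmoothFieldOn.diffFieldAt [IsManifold (𝓡 n) ∞ M] {X : RoughField n M}
    {U : TopologicalSpace.Opens M} (h : SmoothFieldOn X (U : Set M)) {x : M} (hx : x ∈ U) :
    DiffFieldAt X x :=
  ((h x hx).contMDiffAt (U.isOpen.mem_nhds hx)).mdifferentiableAt (by simp)

/-! ### The Lie algebra of smooth vector fields on an open set -/

/-- The real vector space `𝔛(U)` of smooth vector fields on the open set `U`. A vector field on `U`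
is represented by its extension by zero to `M`, so that two elements are equal exactly when they
agree on `U`. -/
def fields [IsManifold (𝓡 n) ∞ M] (U : TopologicalSpace.Opens M) :
    Submodule ℝ (RoughField n M) where
  carrier := {X | SmoothFieldOn X (U : Set M) ∧ ∀ x ∉ U, X x = 0}
  add_mem' := by
    rintro X Y ⟨hX, hX0⟩ ⟨hY, hY0⟩
    refine ⟨ContMDiffOn.add_section hX hY, fun x hx => ?_⟩
    simp [hX0 x hx, hY0 x hx]
  zero_mem' := ⟨contMDiffOn_zeroSection _ _, fun _ _ => rfl⟩
  smul_mem' := by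
    rintro c X ⟨hX, hX0⟩
    refine ⟨ContMDiffOn.const_smul_section hX, fun x hx => ?_⟩
    simp [hX0 x hx]

variable {U : TopologicalSpace.Opens M}

open Classical in
/-- The Lie bracket of vector fields on `U`, extended by zero. -/
noncomputable def bracketOn (U : TopologicalSpace.Opens M) (X Y : RoughField n M) :
    RoughField n M :=
  fun x => if x ∈ U then mlieBracket (𝓡 n) X Y x else 0

theorem bracketOn_apply {X Y : RoughField n M} {x : M} (hx : x ∈ U) :
    bracketOn U X Y x = mlieBracket (𝓡 n) X Y x := if_pos hx

theorem bracketOn_apply_of_notMem {X Y : RoughField n M} {x : M} (hx : x ∉ U) :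
    bracketOn U X Y x = 0 := if_neg hx

theorem bracketOn_eventuallyEq {X Y : RoughField n M} {x : M} (hx : x ∈ U) :
    bracketOn U X Y =ᶠ[nhds x] mlieBracket (𝓡 n) X Y := by
  filter_upwards [U.isOpen.mem_nhds hx] with y hy using bracketOn_apply hy

variable [IsManifold (𝓡 n) ∞ M]

theorem isManifold_of_le {k : WithTop ℕ∞} (hk : k ≤ ∞) : IsManifold (𝓡 n) k M :=
  IsManifold.of_le hk

theorem natCast_le_smooth (k : ℕ) : (k : WithTop ℕ∞) ≤ ∞ := by
  exact_mod_cast (le_top : (k : ℕ∞) ≤ ⊤)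

theorem bracketOn_mem {X Y : RoughField n M} (hX : X ∈ fields U) (hY : Y ∈ fields U) :
    bracketOn U X Y ∈ fields U := by
  refine ⟨fun x hx => ?_, fun x hx => bracketOn_apply_of_notMem hx⟩
  have hX' := (hX.1 x hx).contMDiffAt (U.isOpen.mem_nhds hx)
  have hY' := (hY.1 x hx).contMDiffAt (U.isOpen.mem_nhds hx)
  have : IsManifold (𝓡 n) (((⊤ : ℕ∞) : WithTop ℕ∞) + 1) M := ‹IsManifold (𝓡 n) ∞ M›
  have : IsManifold (𝓡 n) (minSmoothness ℝ 2) M :=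
    isManifold_of_le (by simpa using natCast_le_smooth 2)
  have h := ContMDiffAt.mlieBracket_vectorField (m := ⊤) (n := ⊤) hX' hY' (by simp)
  refine (h.congr_of_eventuallyEq ?_).contMDiffWithinAt
  filter_upwards [bracketOn_eventuallyEq (X := X) (Y := Y) hx] with y hy
  rw [hy]

noncomputable instance : Bracket (fields (n := n) U) (fields (n := n) U) :=
  ⟨fun X Y => ⟨bracketOn U X Y, bracketOn_mem X.2 Y.2⟩⟩

theorem coe_bracket (X Y : fields (n := n) U) :
    ((⁅X, Y⁆ : fields (n := n) U) : RoughField n M) = bracketOn U X Y := rfl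

theorem coe_bracket_apply (X Y : fields (n := n) U) {x : M} (hx : x ∈ U) :
    ((⁅X, Y⁆ : fields (n := n) U) : RoughField n M) x = mlieBracket (𝓡 n) X Y x :=
  bracketOn_apply hx

theorem fields_ext {X Y : fields (n := n) U}
    (h : ∀ x ∈ U, (X : RoughField n M) x = (Y : RoughField n M) x) : X = Y := by
  apply Subtype.ext
  funext x
  by_cases hx : x ∈ U
  · exact h x hx
  · rw [X.2.2 x hx, Y.2.2 x hx]

noncomputable instance : LieRing (fields (n := n) U) where
  add_lie X Y Z := fields_ext fun x hx => by
    have := isManifold_of_le (n := n) (M := M) (k := 1) (by simp)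
    simp only [Submodule.coe_add, Pi.add_apply, coe_bracket_apply _ _ hx]
    exact mlieBracket_add_left (X.2.1.diffFieldAt hx) (Y.2.1.diffFieldAt hx)
  lie_add X Y Z := fields_ext fun x hx => by
    simp only [Submodule.coe_add, Pi.add_apply, coe_bracket_apply _ _ hx]
    exact mlieBracket_add_right (Y.2.1.diffFieldAt hx) (Z.2.1.diffFieldAt hx)
  lie_self X := fields_ext fun x hx => by
    rw [coe_bracket_apply _ _ hx, mlieBracket_self]; rfl
  leibniz_lie X Y Z := fields_ext fun x hx => by
    have : IsManifold (𝓡 n) (minSmoothness ℝ 3) M := isManifold_of_le (by simpa using natCast_le_smooth 3)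
    simp only [Submodule.coe_add, Pi.add_apply, coe_bracket, bracketOn_apply hx]
    have e (W : fields (n := n) U) :
        ContMDiffAt (𝓡 n) ((𝓡 n).prod 𝓘(ℝ, Model n)) (minSmoothness ℝ 2)
          (fun x => (⟨x, (W : RoughField n M) x⟩ :
            TotalSpace (Model n) (TangentSpace (𝓡 n) : M → Type))) x :=
      ((W.2.1 x hx).contMDiffAt (U.isOpen.mem_nhds hx)).of_le (by simpa using natCast_le_smooth 2)
    have l (A B C : RoughField n M) :
        mlieBracket (𝓡 n) (bracketOn U A B) C x = mlieBracket (𝓡 n) (mlieBracket (𝓡 n) A B) C x :=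
      (bracketOn_eventuallyEq hx).mlieBracket_vectorField_eq (Filter.EventuallyEq.refl _ _)
    have r (A B C : RoughField n M) :
        mlieBracket (𝓡 n) A (bracketOn U B C) x = mlieBracket (𝓡 n) A (mlieBracket (𝓡 n) B C) x :=
      (Filter.EventuallyEq.refl _ _).mlieBracket_vectorField_eq (bracketOn_eventuallyEq hx)
    rw [l, r, r]
    exact leibniz_identity_mlieBracket_apply (e X) (e Y) (e Z)

noncomputable instance : LieAlgebra ℝ (fields (n := n) U) where
  lie_smul c X Y := fields_ext fun x hx => by
    simp only [Submodule.coe_smul, Pi.smul_apply, coe_bracket_apply _ _ hx]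
    exact mlieBracket_const_smul_right (Y.2.1.diffFieldAt hx)

/-! ### Pseudo-Riemannian metrics, distributions, Walker manifolds -/

variable (n M) in
/-- A smooth pseudo-Riemannian metric: a smooth, symmetric, pointwise non-degenerate
`(0,2)`-tensor field. -/
structure PseudoRiemannianMetric where
  /-- The bilinear form on each tangent space. -/
  inner (x : M) : TangentSpace (𝓡 n) x →L[ℝ] TangentSpace (𝓡 n) x →L[ℝ] ℝ
  symm (x : M) (v w : TangentSpace (𝓡 n) x) : inner x v w = inner x w v
  nondegenerate (x : M) (v : TangentSpace (𝓡 n) x) (hv : ∀ w, inner x v w = 0) : v = 0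
  contMDiff : ContMDiff (𝓡 n) ((𝓡 n).prod 𝓘(ℝ, Model n →L[ℝ] Model n →L[ℝ] ℝ)) ∞
    (fun x => TotalSpace.mk' (Model n →L[ℝ] Model n →L[ℝ] ℝ)
      (E := fun x : M => TangentSpace (𝓡 n) x →L[ℝ] TangentSpace (𝓡 n) x →L[ℝ] ℝ) x (inner x))

variable (n M) in
/-- Affine connections on `M`; the value of `∇ Y x v` is `∇_v Y`. -/
abbrev Connection : Type _ :=
  CovariantDerivative (𝓡 n) (Model n) (TangentSpace (𝓡 n) : M → Type)

/-- `∇` is the Levi-Civita connection of `g`: it is torsion-free,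
`∇_X Y - ∇_Y X = [X, Y]`, and metric, `v (g(Y, Z)) = g(∇_v Y, Z) + g(Y, ∇_v Z)`. -/
structure PseudoRiemannianMetric.IsLeviCivita (g : PseudoRiemannianMetric n M)
    (nabla : Connection n M) : Prop where
  torsion_free (X Y : RoughField n M) (x : M) (hX : DiffFieldAt X x) (hY : DiffFieldAt Y x) :
    nabla Y x (X x) - nabla X x (Y x) = mlieBracket (𝓡 n) X Y x
  metric (Y Z : RoughField n M) (x : M) (hY : DiffFieldAt Y x) (hZ : DiffFieldAt Z x)
    (v : TangentSpace (𝓡 n) x) :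
    mvfderiv (𝓡 n) (fun y => g.inner y (Y y) (Z y)) x v =
      g.inner x (nabla Y x v) (Z x) + g.inner x (Y x) (nabla Z x v)

variable (n M) in
/-- A smooth distribution of rank `r`: a field of `r`-dimensional subspaces of the tangent spaces
that is locally spanned by smooth vector fields. -/
structure Distribution (r : ℕ) where
  /-- The subspace at each point. -/
  space (x : M) : Submodule ℝ (TangentSpace (𝓡 n) x)
  finrank_space (x : M) : Module.finrank ℝ (space x) = r
  smooth (x : M) : ∃ (V : TopologicalSpace.Opens M) (X : Fin r → RoughField n M), x ∈ V ∧
    (∀ i, SmoothFieldOn (X i) (V : Set M)) ∧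
    ∀ y ∈ V, Submodule.span ℝ (Set.range fun i => X i y) = space y

/-- `D` is a null parallel distribution of `(M, g)`, with Levi-Civita connection `∇`: it is totally
isotropic, and `∇_v Y` lies in `D` for every smooth section `Y` of `D` and every tangent vector `v`.
Thus `(M, g)` is a Walker manifold of rank `r` with null parallel distribution `D`. -/
structure Distribution.IsNullParallel {r : ℕ} (D : Distribution n M r)
    (g : PseudoRiemannianMetric n M) (nabla : Connection n M) : Prop where
  isotropic (x : M) (v w : TangentSpace (𝓡 n) x) (hv : v ∈ D.space x) (hw : w ∈ D.space x) :
    g.inner x v w = 0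
  parallel (Y : RoughField n M) (hY : SmoothFieldOn Y Set.univ) (hYD : ∀ x, Y x ∈ D.space x)
    (x : M) (v : TangentSpace (𝓡 n) x) : nabla Y x v ∈ D.space x

/-! ### The structure algebra -/

/-- `X`, a smooth vector field on the open set `U`, is a parallel section of `D` over `U`: it is
tangent to `D` and `∇ X = 0` on `U`. -/
def IsParallelSection {r : ℕ} (nabla : Connection n M) (D : Distribution n M r)
    (X : fields (n := n) U) : Prop :=
  ∀ x ∈ U, (X : RoughField n M) x ∈ D.space x ∧ nabla (X : RoughField n M) x = 0

/-- `X₁, …, X_r`, smooth vector fields on the open set `U`, form a basis of sections of `D` over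
`U`: at each point of `U` their values are a basis of `D`. -/
structure IsLocalBasis {r : ℕ} (D : Distribution n M r) (X : Fin r → fields (n := n) U) :
    Prop where
  linearIndependent (x : M) (hx : x ∈ U) :
    LinearIndependent ℝ fun i => (X i : RoughField n M) x
  span_eq (x : M) (hx : x ∈ U) :
    Submodule.span ℝ (Set.range fun i => (X i : RoughField n M) x) = D.space x

/-- `X₁, …, X_r` is a basis of parallel sections of `D` over the open set `U`. -/
structure IsParallelBasis {r : ℕ} (nabla : Connection n M) (D : Distribution n M r)
    (X : Fin r → fields (n := n) U) : Prop extends IsLocalBasis D X where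
  isParallelSection (i : Fin r) : IsParallelSection nabla D (X i)

/-- The structure algebra attached to a basis `X₁, …, X_r` of parallel sections over `U`: the real
Lie algebra that these vector fields generate, with the Lie bracket of vector fields. That its
underlying vector space is just the real linear span of `X₁, …, X_r`, i.e. that
`[X_i, X_j] = ∑ c_ij^k X_k` with real constants, is not built into the definition. -/
noncomputable def structureAlgebra {r : ℕ} (X : Fin r → fields (n := n) U) :
    LieSubalgebra ℝ (fields (n := n) U) :=
  LieSubalgebra.lieSpan ℝ (fields (n := n) U) (Set.range X)

end Manifold

/-! ### The two-dimensional model algebras -/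

/-- The abelian Lie algebra `ℝ^r`. -/
def AbelianAlgebra (r : ℕ) : Type := Fin r → ℝ

noncomputable instance (r : ℕ) : AddCommGroup (AbelianAlgebra r) :=
  inferInstanceAs (AddCommGroup (Fin r → ℝ))

noncomputable instance (r : ℕ) : Module ℝ (AbelianAlgebra r) :=
  inferInstanceAs (Module ℝ (Fin r → ℝ))

noncomputable instance (r : ℕ) : LieRing (AbelianAlgebra r) where
  bracket _ _ := 0
  add_lie _ _ _ := (add_zero 0).symm
  lie_add _ _ _ := (add_zero 0).symm
  lie_self _ := rfl
  leibniz_lie _ _ _ := (add_zero 0).symm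

noncomputable instance (r : ℕ) : LieAlgebra ℝ (AbelianAlgebra r) where
  lie_smul c _ _ := (smul_zero c).symm

section Affine

attribute [local instance] LieRing.ofAssociativeRing

/-- The Lie algebra `𝔞𝔣𝔣(ℝ)` of the affine group of the line, as the Lie algebra of real matrices
`!![a, b; 0, 0]`. -/
def aff : LieSubalgebra ℝ (Matrix (Fin 2) (Fin 2) ℝ) where
  carrier := {A | A 1 0 = 0 ∧ A 1 1 = 0}
  add_mem' := by
    rintro A B ⟨h₁, h₂⟩ ⟨h₃, h₄⟩
    simp [h₁, h₂, h₃, h₄]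
  zero_mem' := by simp
  smul_mem' := by
    rintro c A ⟨h₁, h₂⟩
    simp [h₁, h₂]
  lie_mem' := by
    rintro A B ⟨h₁, h₂⟩ ⟨h₃, h₄⟩
    simp [Ring.lie_def, Matrix.mul_apply, h₁, h₂, h₃, h₄]

end Affine

end Walker

/-! Torsion-freeness writes `[X, Y]` as `∇_X Y - ∇_Y X`, so parallel fields commute. Hence the span
of a parallel basis is already closed under the bracket, with zero bracket; independence at one
point makes it two-dimensional, so it is `ℝ²`, and `aff`, which has a non-zero bracket, is excluded.
Commuting frames near every point need another argument, since parallel frames may not exist.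
Torsion-freeness and parallelism make `D` involutive (`bracket_mem`). Choose functions `f_j` and a
frame `X_i` of `D` with `X_i f_j = δ_ij` (`exists_dual_basis`). These derivatives are constant, so
`[X_0, X_1]` kills both `f_j` (`mvfderiv_bracket_eq_zero`); but it is a combination of the `X_i`,
whose coefficients the `df_j` read off, so it vanishes. This bypasses the Frobenius theorem. -/

namespace Walker

/-! ### Vector fields acting on functions -/

section Fields

variable {n : ℕ} {M : Type*} [TopologicalSpace M] [ChartedSpace (Model n) M]
  [IsManifold (𝓡 n) ∞ M] {U : TopologicalSpace.Opens M}

open Classical in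
/-- The restriction to `U`, extended by zero, of a vector field that is smooth on `U`. -/
noncomputable def fieldOn (X : RoughField n M) (hX : SmoothFieldOn X (U : Set M)) :
    fields (n := n) U :=
  ⟨fun x => if x ∈ U then X x else 0, by
    refine ⟨hX.congr fun x hx => ?_, fun x hx => if_neg hx⟩
    have hx' : x ∈ U := hx
    simp [hx']⟩

theorem fieldOn_apply {X : RoughField n M} (hX : SmoothFieldOn X (U : Set M)) {x : M}
    (hx : x ∈ U) : (fieldOn X hX : RoughField n M) x = X x := if_pos hx

/-- The product of a smooth function on `U` and a vector field on `U`. -/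
noncomputable def smulField (f : M → ℝ) (hf : ContMDiffOn (𝓡 n) 𝓘(ℝ) ∞ f (U : Set M))
    (X : fields (n := n) U) : fields (n := n) U :=
  ⟨f • (X : RoughField n M), by
    refine ⟨ContMDiffOn.smul_section hf X.2.1, fun x hx => ?_⟩
    simp [X.2.2 x hx]⟩

theorem smulField_apply {f : M → ℝ} (hf : ContMDiffOn (𝓡 n) 𝓘(ℝ) ∞ f (U : Set M))
    (X : fields (n := n) U) (x : M) :
    (smulField f hf X : RoughField n M) x = f x • (X : RoughField n M) x := rfl

theorem bracket_smulField_apply {f : M → ℝ} (hf : ContMDiffOn (𝓡 n) 𝓘(ℝ) ∞ f (U : Set M))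
    (X Z : fields (n := n) U) {x : M} (hx : x ∈ U) :
    ((⁅X, smulField f hf Z⁆ : fields (n := n) U) : RoughField n M) x =
      mvfderiv (𝓡 n) f x ((X : RoughField n M) x) • (Z : RoughField n M) x +
        f x • ((⁅X, Z⁆ : fields (n := n) U) : RoughField n M) x := by
  have : IsManifold (𝓡 n) 2 M := isManifold_of_le (by simpa using natCast_le_smooth 2)
  rw [coe_bracket_apply _ _ hx, coe_bracket_apply _ _ hx]
  exact mlieBracket_smul_right
    (((hf x hx).contMDiffAt (U.isOpen.mem_nhds hx)).mdifferentiableAt (by simp))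
    (Z.2.1.diffFieldAt hx)

/-- Leibniz rule with constant `X f`: the derivative term becomes a real multiple of `Z`, so the
identity lives in the Lie algebra and can be bracketed again. -/
theorem bracket_smulField {f : M → ℝ} (hf : ContMDiffOn (𝓡 n) 𝓘(ℝ) ∞ f (U : Set M))
    (X Z : fields (n := n) U) {a : ℝ}
    (ha : ∀ x ∈ U, mvfderiv (𝓡 n) f x ((X : RoughField n M) x) = a) :
    ⁅X, smulField f hf Z⁆ = a • Z + smulField f hf ⁅X, Z⁆ := by
  refine fields_ext fun x hx => ?_
  rw [bracket_smulField_apply hf X Z hx, ha x hx]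
  rfl

/-- If `X f` and `Y f` are constant, then `[X, Y] f` vanishes. -/
theorem mvfderiv_bracket_eq_zero {f : M → ℝ} (hf : ContMDiffOn (𝓡 n) 𝓘(ℝ) ∞ f (U : Set M))
    (X Y Z : fields (n := n) U) {a b : ℝ}
    (ha : ∀ x ∈ U, mvfderiv (𝓡 n) f x ((X : RoughField n M) x) = a)
    (hb : ∀ x ∈ U, mvfderiv (𝓡 n) f x ((Y : RoughField n M) x) = b)
    {x : M} (hx : x ∈ U) (hZ : (Z : RoughField n M) x ≠ 0) :
    mvfderiv (𝓡 n) f x (((⁅X, Y⁆ : fields (n := n) U) : RoughField n M) x) = 0 := by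
  -- Jacobi identity for `X`, `Y`, `f Z`: after expansion the terms with `a` and `b` cancel, Jacobi
  -- for `X`, `Y`, `Z` removes those with `f`, and `([X, Y] f) Z = 0` remains.
  have h := lie_lie X Y (smulField f hf Z)
  rw [bracket_smulField hf X Z ha, bracket_smulField hf Y Z hb, lie_add, lie_add, lie_smul,
    lie_smul, bracket_smulField hf X _ ha, bracket_smulField hf Y _ hb] at h
  have h' := congrArg (fun W : fields (n := n) U => (W : RoughField n M) x) h
  have e : ((⁅⁅X, Y⁆, Z⁆ : fields (n := n) U) : RoughField n M) x =
      ((⁅X, ⁅Y, Z⁆⁆ : fields (n := n) U) : RoughField n M) x -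
        ((⁅Y, ⁅X, Z⁆⁆ : fields (n := n) U) : RoughField n M) x := by
    rw [lie_lie]; rfl
  simp only [bracket_smulField_apply hf _ _ hx, e, Submodule.coe_sub, Submodule.coe_add,
    Submodule.coe_smul, Pi.sub_apply, Pi.add_apply, Pi.smul_apply, smulField_apply] at h'
  refine (smul_eq_zero.mp ?_).resolve_right hZ
  have h'' := sub_eq_zero.mpr h'
  rw [← h'']
  module

/-- The derivative of a smooth function along a smooth vector field is smooth. -/
theorem contMDiffOn_mvfderiv {f : M → ℝ} (hf : ContMDiffOn (𝓡 n) 𝓘(ℝ) ∞ f (U : Set M))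
    {X : RoughField n M} (hX : SmoothFieldOn X (U : Set M)) :
    ContMDiffOn (𝓡 n) 𝓘(ℝ) ∞ (fun x => mvfderiv (𝓡 n) f x (X x)) (U : Set M) := by
  have h1 : IsManifold (𝓡 n) 1 M := isManifold_of_le (by simp)
  -- The derivative is the fibre component of the tangent map of `f` composed with the section `X`.
  have h := (hf.contMDiffOn_tangentMapWithin (m := ∞) (by simp) U.isOpen.uniqueMDiffOn).comp hX
    (fun x hx => hx)
  have h2 := (contMDiff_snd_tangentBundle_modelSpace ℝ 𝓘(ℝ) (n := ∞)).comp_contMDiffOn h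
  refine h2.congr fun x hx => ?_
  simp only [Function.comp, tangentMapWithin, mfderivWithin_of_isOpen U.isOpen hx]
  rfl

/-- A smooth vector field on `U` agrees near each point of `U` with a global multiple of itself. -/
theorem exists_global_smul [T2Space M] (X : fields (n := n) U) {x : M} (hx : x ∈ U) :
    ∃ ρ : M → ℝ, SmoothFieldOn (ρ • (X : RoughField n M)) Set.univ ∧ ρ =ᶠ[nhds x] 1 := by
  obtain ⟨ρ, -, hρ⟩ := (SmoothBumpFunction.nhds_basis_tsupport (I := 𝓡 n) x).mem_iff.mp
    (U.isOpen.mem_nhds hx)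
  refine ⟨ρ, ?_, ρ.eventuallyEq_one⟩
  exact contMDiffOn_univ.mpr
    (ContMDiffOn.smul_section_of_tsupport ρ.contMDiff.contMDiffOn U.isOpen hρ X.2.1)

end Fields

/-! ### Consequences of torsion-freeness and parallelism -/

section Connection

variable {n r : ℕ} {M : Type*} [TopologicalSpace M] [ChartedSpace (Model n) M]
  [IsManifold (𝓡 n) ∞ M] {U : TopologicalSpace.Opens M} {g : PseudoRiemannianMetric n M}
  {nabla : Connection n M} {D : Distribution n M r}

theorem PseudoRiemannianMetric.IsLeviCivita.bracket_apply (h : g.IsLeviCivita nabla)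
    (X Y : fields (n := n) U) {x : M} (hx : x ∈ U) :
    ((⁅X, Y⁆ : fields (n := n) U) : RoughField n M) x =
      nabla (Y : RoughField n M) x ((X : RoughField n M) x) -
        nabla (X : RoughField n M) x ((Y : RoughField n M) x) := by
  rw [coe_bracket_apply _ _ hx]
  exact (h.torsion_free _ _ x (X.2.1.diffFieldAt hx) (Y.2.1.diffFieldAt hx)).symm

theorem PseudoRiemannianMetric.IsLeviCivita.bracket_eq_zero (h : g.IsLeviCivita nabla)
    {X Y : fields (n := n) U} (hX : IsParallelSection nabla D X)
    (hY : IsParallelSection nabla D Y) : ⁅X, Y⁆ = 0 := by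
  refine fields_ext fun x hx => ?_
  rw [h.bracket_apply X Y hx, (hX x hx).2, (hY x hx).2]
  simp

/-- Parallelism is postulated for global sections only; a bump function globalises a local section
without changing its germ at `x`, on which `∇` depends. -/
theorem Distribution.IsNullParallel.nabla_mem [T2Space M] (h : D.IsNullParallel g nabla)
    {X : fields (n := n) U} (hX : ∀ x ∈ U, (X : RoughField n M) x ∈ D.space x) {x : M}
    (hx : x ∈ U) (v : TangentSpace (𝓡 n) x) : nabla (X : RoughField n M) x v ∈ D.space x := by
  obtain ⟨ρ, hρ, hρ1⟩ := exists_global_smul X hx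
  have e : nabla (X : RoughField n M) x = nabla (ρ • (X : RoughField n M)) x := by
    refine nabla.isCovariantDerivativeOnUniv.congr_of_eventuallyEq (X.2.1.diffFieldAt hx)
      (SmoothFieldOn.diffFieldAt (U := ⊤) hρ trivial) Filter.univ_mem ?_
    filter_upwards [hρ1] with y hy
    simp [hy]
  rw [e]
  refine h.parallel _ hρ (fun y => Submodule.smul_mem _ _ ?_) x v
  by_cases hy : y ∈ U
  · exact hX y hy
  · rw [X.2.2 y hy]; exact zero_mem _

/-- Involutivity: both terms of `∇_X Y - ∇_Y X` stay in `D`. -/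
theorem Distribution.IsNullParallel.bracket_mem [T2Space M] (h : D.IsNullParallel g nabla)
    (hLC : g.IsLeviCivita nabla) {X Y : fields (n := n) U}
    (hX : ∀ x ∈ U, (X : RoughField n M) x ∈ D.space x)
    (hY : ∀ x ∈ U, (Y : RoughField n M) x ∈ D.space x) {x : M} (hx : x ∈ U) :
    ((⁅X, Y⁆ : fields (n := n) U) : RoughField n M) x ∈ D.space x := by
  rw [hLC.bracket_apply X Y hx]
  exact sub_mem (h.nabla_mem hY hx _) (h.nabla_mem hX hx _)

end Connection

/-! ### Dual frames and commuting frames of a rank-two distribution -/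

section RankTwo

variable {n : ℕ} {M : Type*} [TopologicalSpace M] [ChartedSpace (Model n) M]
  [IsManifold (𝓡 n) ∞ M] {U : TopologicalSpace.Opens M}

theorem Distribution.linearIndependent_of_span_eq {r : ℕ} (D : Distribution n M r) {x : M}
    {v : Fin r → TangentSpace (𝓡 n) x} (h : Submodule.span ℝ (Set.range v) = D.space x) :
    LinearIndependent ℝ v := by
  rw [linearIndependent_iff_card_eq_finrank_span, Set.finrank, h, D.finrank_space, Fintype.card_fin]

theorem Distribution.span_eq_of_linearIndependent {r : ℕ} (D : Distribution n M r) {x : M}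
    {v : Fin r → TangentSpace (𝓡 n) x} (hv : LinearIndependent ℝ v)
    (h : ∀ i, v i ∈ D.space x) : Submodule.span ℝ (Set.range v) = D.space x := by
  have : FiniteDimensional ℝ (TangentSpace (𝓡 n) x) :=
    inferInstanceAs (FiniteDimensional ℝ (Model n))
  refine Submodule.eq_of_le_of_finrank_eq (Submodule.span_le.mpr ?_) ?_
  · rintro _ ⟨i, rfl⟩; exact h i
  · rw [finrank_span_eq_card hv, Fintype.card_fin, D.finrank_space]

/-- Linearly independent tangent vectors at `p` admit dual functions, smooth near `p`. -/
theorem exists_dual_functions {r : ℕ} (p : M) {v : Fin r → TangentSpace (𝓡 n) p}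
    (hv : LinearIndependent ℝ v) : ∃ (V : TopologicalSpace.Opens M) (f : Fin r → M → ℝ), p ∈ V ∧
      (∀ j, ContMDiffOn (𝓡 n) 𝓘(ℝ) ∞ (f j) (V : Set M)) ∧
      ∀ i j, mvfderiv (𝓡 n) (f j) p (v i) = if i = j then 1 else 0 := by
  have h1 : IsManifold (𝓡 n) 1 M := isManifold_of_le (by simp)
  let φ := extChartAt (𝓡 n) p
  let A : TangentSpace (𝓡 n) p →L[ℝ] Model n := mfderiv (𝓡 n) 𝓘(ℝ, Model n) φ p
  have hA : A.IsInvertible := isInvertible_mfderiv_extChartAt (mem_extChartAt_source p)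
  have hw : LinearIndependent ℝ (A ∘ v) :=
    hv.map' A.toLinearMap (LinearMap.ker_eq_bot.mpr hA.injective)
  -- The components of a left inverse `L` are linear forms dual to the vectors read in the chart;
  -- composed with the chart they give the functions.
  obtain ⟨L, hL⟩ := LinearMap.exists_leftInverse_of_injective (Fintype.linearCombination ℝ (A ∘ v))
    (LinearMap.ker_eq_bot.mpr hw.fintypeLinearCombination_injective)
  have hLv (i : Fin r) : L (A (v i)) = Pi.single i 1 := by
    have := LinearMap.congr_fun hL (Pi.single i 1)
    simpa [Fintype.linearCombination_apply_single] using this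
  let ℓ (j : Fin r) : Model n →L[ℝ] ℝ := LinearMap.toContinuousLinearMap (LinearMap.proj j ∘ₗ L)
  have hφ : ContMDiffOn (𝓡 n) 𝓘(ℝ, Model n) ∞ φ (chartAt (Model n) p).source :=
    contMDiffOn_extChartAt
  refine ⟨⟨(chartAt (Model n) p).source, (chartAt (Model n) p).open_source⟩, fun j => ℓ j ∘ φ,
    mem_chart_source _ p, fun j => (ℓ j).contMDiff.comp_contMDiffOn hφ, fun i j => ?_⟩
  have hd : MDifferentiableAt (𝓡 n) 𝓘(ℝ, Model n) φ p :=
    mdifferentiableAt_extChartAt (mem_chart_source _ p)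
  have e : mvfderiv (𝓡 n) (ℓ j ∘ φ) p (v i) = ℓ j (A (v i)) := by
    change mfderiv (𝓡 n) 𝓘(ℝ) (ℓ j ∘ φ) p (v i) = _
    rw [mfderiv_comp p ((ℓ j).mdifferentiableAt) hd, (ℓ j).mfderiv_eq]
    rfl
  rw [e]
  change L (A (v i)) j = _
  rw [hLv, Pi.single_apply]
  simp only [eq_comm]

/-- Near every point, a smooth distribution of rank two has a local basis dual to a pair of
smooth functions. -/
theorem Distribution.exists_dual_basis (D : Distribution n M 2) (p : M) :
    ∃ (V : TopologicalSpace.Opens M) (X : Fin 2 → fields (n := n) V) (f : Fin 2 → M → ℝ),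
      p ∈ V ∧ IsLocalBasis D X ∧ (∀ j, ContMDiffOn (𝓡 n) 𝓘(ℝ) ∞ (f j) (V : Set M)) ∧
      ∀ i j, ∀ x ∈ V, mvfderiv (𝓡 n) (f j) x ((X i : RoughField n M) x) =
        if i = j then 1 else 0 := by
  obtain ⟨V₁, Y, hp₁, hY, hYD⟩ := D.smooth p
  obtain ⟨V₂, f, hp₂, hf, hfY⟩ :=
    exists_dual_functions p (D.linearIndependent_of_span_eq (hYD p hp₁))
  -- The matrix `Y_i f_j` is the identity at `p`, hence invertible where its determinant `d` is
  -- non-zero; the dual frame is its inverse applied to `Y`, by Cramer's rule.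
  let a (i j : Fin 2) (x : M) : ℝ := mvfderiv (𝓡 n) (f j) x (Y i x)
  have ha (i j : Fin 2) : ContMDiffOn (𝓡 n) 𝓘(ℝ) ∞ (a i j) ((V₁ ⊓ V₂ : TopologicalSpace.Opens M) : Set M) :=
    contMDiffOn_mvfderiv ((hf j).mono Set.inter_subset_right) ((hY i).mono Set.inter_subset_left)
  let d (x : M) : ℝ := a 0 0 x * a 1 1 x - a 0 1 x * a 1 0 x
  have hd : ContMDiffOn (𝓡 n) 𝓘(ℝ) ∞ d ((V₁ ⊓ V₂ : TopologicalSpace.Opens M) : Set M) :=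
    ((ha 0 0).mul (ha 1 1)).sub ((ha 0 1).mul (ha 1 0))
  let V : TopologicalSpace.Opens M := ⟨((V₁ ⊓ V₂ : TopologicalSpace.Opens M) : Set M) ∩ d ⁻¹' {0}ᶜ,
    hd.continuousOn.isOpen_inter_preimage (V₁ ⊓ V₂).isOpen isOpen_compl_singleton⟩
  have hVle : (V : Set M) ⊆ (V₁ ⊓ V₂ : TopologicalSpace.Opens M) := Set.inter_subset_left
  have hV0 : ∀ x ∈ V, d x ≠ 0 := fun x hx => hx.2
  have hpV : p ∈ V := by
    refine ⟨⟨hp₁, hp₂⟩, ?_⟩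
    simp [d, a, hfY]
  have hc (i j : Fin 2) : ContMDiffOn (𝓡 n) 𝓘(ℝ) ∞ (fun x => a i j x / d x) (V : Set M) :=
    ((ha i j).mono hVle).div₀ (hd.mono hVle) hV0
  let Z (i : Fin 2) : fields (n := n) V := fieldOn (Y i) ((hY i).mono (fun x hx => (hVle hx).1))
  have hZ (i : Fin 2) (x : M) (hx : x ∈ V) : (Z i : RoughField n M) x = Y i x := fieldOn_apply _ hx
  let X : Fin 2 → fields (n := n) V :=
    ![smulField _ (hc 1 1) (Z 0) - smulField _ (hc 0 1) (Z 1),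
      smulField _ (hc 0 0) (Z 1) - smulField _ (hc 1 0) (Z 0)]
  have hX0 (x : M) (hx : x ∈ V) : (X 0 : RoughField n M) x =
      (a 1 1 x / d x) • Y 0 x - (a 0 1 x / d x) • Y 1 x := by
    rw [← hZ 0 x hx, ← hZ 1 x hx]; rfl
  have hX1 (x : M) (hx : x ∈ V) : (X 1 : RoughField n M) x =
      (a 0 0 x / d x) • Y 1 x - (a 1 0 x / d x) • Y 0 x := by
    rw [← hZ 0 x hx, ← hZ 1 x hx]; rfl
  have hXf (i j : Fin 2) (x : M) (hx : x ∈ V) :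
      mvfderiv (𝓡 n) (f j) x ((X i : RoughField n M) x) = if i = j then 1 else 0 := by
    have h0 := hV0 x hx
    have hY' (i : Fin 2) : mvfderiv (𝓡 n) (f j) x (Y i x) = a i j x := rfl
    fin_cases i <;> fin_cases j <;>
      simp only [Fin.zero_eta, Fin.mk_one, hX0 x hx, hX1 x hx, map_sub, map_smul, smul_eq_mul] at * <;>
      rw [hY', hY'] <;> simp <;> field_simp <;> simp [d] <;> ring
  have hXD (i : Fin 2) (x : M) (hx : x ∈ V) : (X i : RoughField n M) x ∈ D.space x := by
    have hYm (i : Fin 2) : Y i x ∈ D.space x := by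
      rw [← hYD x (hVle hx).1]; exact Submodule.subset_span ⟨i, rfl⟩
    fin_cases i
    · exact hX0 x hx ▸ sub_mem (Submodule.smul_mem _ _ (hYm 0)) (Submodule.smul_mem _ _ (hYm 1))
    · exact hX1 x hx ▸ sub_mem (Submodule.smul_mem _ _ (hYm 1)) (Submodule.smul_mem _ _ (hYm 0))
  have hli (x : M) (hx : x ∈ V) : LinearIndependent ℝ fun i => (X i : RoughField n M) x := by
    refine Fintype.linearIndependent_iff.mpr fun c hc j => ?_
    have := congrArg (mvfderiv (𝓡 n) (f j) x) hc
    fin_cases j <;> simpa [hXf _ _ x hx, map_sum] using this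
  exact ⟨V, X, f, hpV, ⟨hli, fun x hx => D.span_eq_of_linearIndependent (hli x hx)
    fun i => hXD i x hx⟩, fun j => (hf j).mono fun x hx => (hVle hx).2, hXf⟩

theorem IsLocalBasis.mem {r : ℕ} {D : Distribution n M r} {X : Fin r → fields (n := n) U}
    (h : IsLocalBasis D X) (i : Fin r) : ∀ x ∈ U, (X i : RoughField n M) x ∈ D.space x :=
  fun x hx => h.span_eq x hx ▸ Submodule.subset_span ⟨i, rfl⟩

theorem Distribution.IsNullParallel.exists_commuting_basis [T2Space M] {D : Distribution n M 2}
    {g : PseudoRiemannianMetric n M} {nabla : Connection n M} (h : D.IsNullParallel g nabla)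
    (hLC : g.IsLeviCivita nabla) (p : M) :
    ∃ (V : TopologicalSpace.Opens M) (X : Fin 2 → fields (n := n) V),
      p ∈ V ∧ IsLocalBasis D X ∧ ⁅X 0, X 1⁆ = 0 := by
  obtain ⟨V, X, f, hp, hX, hf, hXf⟩ := D.exists_dual_basis p
  refine ⟨V, X, hp, hX, fields_ext fun x hx => ?_⟩
  have hB := h.bracket_mem hLC (hX.mem 0) (hX.mem 1) hx
  rw [← hX.span_eq x hx] at hB
  obtain ⟨c, hc⟩ := (Submodule.mem_span_range_iff_exists_fun ℝ).mp hB
  have hc0 (j : Fin 2) : c j = 0 := by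
    -- The third field `X 0` serves only as a field that does not vanish at `x`.
    have h0 := mvfderiv_bracket_eq_zero (hf j) (X 0) (X 1) (X 0) (hXf 0 j) (hXf 1 j) hx
      ((hX.linearIndependent x hx).ne_zero 0)
    rw [← hc] at h0
    fin_cases j <;> simpa [hXf _ _ x hx, map_sum] using h0
  rw [← hc]
  simp [hc0]

end RankTwo

/-! ### The structure algebra of commuting fields, and `aff` -/

section StructureAlgebra

variable {n r : ℕ} {M : Type*} [TopologicalSpace M] [ChartedSpace (Model n) M]
  [IsManifold (𝓡 n) ∞ M] {U : TopologicalSpace.Opens M} {X : Fin r → fields (n := n) U}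

theorem lie_eq_zero_of_mem_span (h : ∀ i j, ⁅X i, X j⁆ = 0) {Y Z : fields (n := n) U}
    (hY : Y ∈ Submodule.span ℝ (Set.range X)) (hZ : Z ∈ Submodule.span ℝ (Set.range X)) :
    ⁅Y, Z⁆ = 0 := by
  induction hY using Submodule.span_induction with
  | mem Y hY =>
    obtain ⟨i, rfl⟩ := hY
    induction hZ using Submodule.span_induction with
    | mem Z hZ => obtain ⟨j, rfl⟩ := hZ; exact h i j
    | zero => exact lie_zero _
    | add _ _ _ _ h₁ h₂ => rw [lie_add, h₁, h₂, add_zero]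
    | smul c _ _ h₁ => rw [lie_smul, h₁, smul_zero]
  | zero => exact zero_lie _
  | add _ _ _ _ h₁ h₂ => rw [add_lie, h₁, h₂, add_zero]
  | smul c _ _ h₁ => rw [smul_lie, h₁, smul_zero]

theorem structureAlgebra_toSubmodule (h : ∀ i j, ⁅X i, X j⁆ = 0) :
    (structureAlgebra X).toSubmodule = Submodule.span ℝ (Set.range X) := by
  let K : LieSubalgebra ℝ (fields (n := n) U) :=
    { Submodule.span ℝ (Set.range X) with
      lie_mem' := fun {Y Z} hY hZ => by
        rw [lie_eq_zero_of_mem_span h hY hZ]; exact zero_mem (Submodule.span ℝ (Set.range X)) }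
  refine le_antisymm ?_ (Submodule.span_le.mpr LieSubalgebra.subset_lieSpan)
  have : structureAlgebra X ≤ K := LieSubalgebra.lieSpan_le.mpr Submodule.subset_span
  exact this

theorem structureAlgebra_lie_eq_zero (h : ∀ i j, ⁅X i, X j⁆ = 0) (Y Z : structureAlgebra X) :
    ⁅Y, Z⁆ = 0 := by
  have hm (W : structureAlgebra X) : (W : fields (n := n) U) ∈ Submodule.span ℝ (Set.range X) :=
    structureAlgebra_toSubmodule h ▸ W.2
  exact Subtype.ext (lie_eq_zero_of_mem_span h (hm Y) (hm Z))

theorem nonempty_structureAlgebra_equiv (h : ∀ i j, ⁅X i, X j⁆ = 0)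
    (hX : LinearIndependent ℝ X) : Nonempty (structureAlgebra X ≃ₗ⁅ℝ⁆ AbelianAlgebra r) := by
  let e : structureAlgebra X ≃ₗ[ℝ] AbelianAlgebra r :=
    (LinearEquiv.ofEq _ _ (structureAlgebra_toSubmodule h)).trans (Module.Basis.span hX).equivFun
  exact ⟨{ e with
    map_lie' := fun {Y Z} => by
      change e ⁅Y, Z⁆ = 0
      rw [structureAlgebra_lie_eq_zero h, map_zero] }⟩

/-- Evaluation at one point of `U` is linear, and the values there are independent. -/
theorem IsLocalBasis.linearIndependent_fields {D : Distribution n M r} (hX : IsLocalBasis D X)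
    (hU : (U : Set M).Nonempty) : LinearIndependent ℝ X := by
  obtain ⟨x, hx⟩ := hU
  let ev : fields (n := n) U →ₗ[ℝ] TangentSpace (𝓡 n) x :=
    (LinearMap.proj x).comp (fields (n := n) U).subtype
  exact LinearIndependent.of_comp ev (hX.linearIndependent x hx)

attribute [local instance] LieRing.ofAssociativeRing

theorem exists_lie_ne_zero_aff : ∃ A B : aff, ⁅A, B⁆ ≠ 0 := by
  -- The dilation and translation generators satisfy `[A, B] = B`.
  refine ⟨⟨!![1, 0; 0, 0], by simp [aff]⟩, ⟨!![0, 1; 0, 0], by simp [aff]⟩, fun h => ?_⟩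
  have := congrFun (congrFun (congrArg Subtype.val h) 0) 1
  rw [LieSubalgebra.coe_bracket, Ring.lie_def] at this
  simp at this

end StructureAlgebra

end Walker

theorem mainTheorem11 {M : Type*} [TopologicalSpace M] [T2Space M]
    [ChartedSpace (Walker.Model 4) M] [IsManifold (𝓡 4) ∞ M]
    (g : Walker.PseudoRiemannianMetric 4 M)
    (nabla : Walker.Connection 4 M) (hnabla : g.IsLeviCivita nabla)
    (D : Walker.Distribution 4 M 2) (hD : D.IsNullParallel g nabla) :
    -- for every open set `U` with a basis of parallel sections, the structure algebra is `ℝ²`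
    (∀ (U : TopologicalSpace.Opens M) (X : Fin 2 → Walker.fields (n := 4) U),
      (U : Set M).Nonempty → Walker.IsParallelBasis nabla D X →
        (Walker.structureAlgebra X).toSubmodule = Submodule.span ℝ (Set.range X) ∧
        IsLieAbelian (Walker.structureAlgebra X) ∧
        Nonempty (Walker.structureAlgebra X ≃ₗ⁅ℝ⁆ Walker.AbelianAlgebra 2) ∧
        IsEmpty (Walker.structureAlgebra X ≃ₗ⁅ℝ⁆ Walker.aff)) ∧
    -- without assuming that such a basis exists, parallel sections of `D` commute
    (∀ (U : TopologicalSpace.Opens M) (X Y : Walker.fields (n := 4) U),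
      Walker.IsParallelSection nabla D X → Walker.IsParallelSection nabla D Y → ⁅X, Y⁆ = 0) ∧
    -- and near every point `D` is spanned by two commuting vector fields
    (∀ p : M, ∃ (V : TopologicalSpace.Opens M) (X : Fin 2 → Walker.fields (n := 4) V),
      p ∈ V ∧ Walker.IsLocalBasis D X ∧ ⁅X 0, X 1⁆ = 0) := by
  have hcomm {U : TopologicalSpace.Opens M} {X : Fin 2 → Walker.fields (n := 4) U}
      (hX : Walker.IsParallelBasis nabla D X) (i j : Fin 2) : ⁅X i, X j⁆ = 0 :=
    hnabla.bracket_eq_zero (hX.isParallelSection i) (hX.isParallelSection j)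
  refine ⟨fun U X hU hX => ⟨Walker.structureAlgebra_toSubmodule (hcomm hX),
    ⟨fun Y Z => Walker.structureAlgebra_lie_eq_zero (hcomm hX) Y Z⟩,
    Walker.nonempty_structureAlgebra_equiv (hcomm hX)
      (hX.toIsLocalBasis.linearIndependent_fields hU), ⟨fun e => ?_⟩⟩,
    fun U X Y hX hY => hnabla.bracket_eq_zero hX hY, hD.exists_commuting_basis hnabla⟩
  obtain ⟨A, B, hAB⟩ := Walker.exists_lie_ne_zero_aff
  refine hAB (e.symm.injective ?_)
  exact (LieHom.map_lie _ A B).trans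
    ((Walker.structureAlgebra_lie_eq_zero (hcomm hX) _ _).trans (map_zero e.symm.toLieHom).symm)
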